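/- Let $V$ and $Q$ be separable real Hilbert spaces with duals $V',Q'$, let $X=V\times Q$, and identify $X'$ with $V'\times Q'$ through $\langle (g,h),(v,q)\rangle=\langle g,v\rangle+\langle h,q\rangle$. Let $L\in\mathcal L(V,V')$, $B\in\mathcal L(V,Q')$, $T\in\mathcal L(Q,Q')$ be continuous linear operators, let $B^*\in\mathcal L(Q,V')$ be given by $\langle B^*p,v\rangle=\langle Bv,p\rangle$, let $C:V\to V'$ be a (possibly nonlinear) map, and define $$A:X\to X',\qquad A(u,p)=\bigl(C(u)+Lu-B^*p,\; Bu+Tp\bigr).$$ Assume that $A$ is weak-$*$-continuous, i.e. $x_n\rightharpoonup x$ in $X$ implies $A(x_n)\stackrel{*}{\rightharpoonup}A(x)$ in $X'$, and that - (A1) there is $\alpha>0$ with $\langle Lu,u\rangle\ge\alpha\|u\|_V^2$ for all $u\in V$; - (A2a) $\langle Tp,p\rangle\ge 0$ for all $p\in Q$; - (A2b) there are $\Theta\in\mathcal L(Q,V)$ and $c_T\in\mathbb R$ with $\langle B^*p,\Theta p\rangle\ge\tfrac12\|p\|_Q^2-c_T\langle Tp,p\rangle$ for all $p\in Q$; -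 (A3) $\langle C(u),u\rangle\ge0$ for all $u\in V$; - (A4) there is a constant $c_N$ with $\|C(u)\|_{V'}\le c_N\|u\|_V^2$ for all $u\in V$. Then for every $f\in V'$ the equation $A(x)=(f,0)$ has a solution $x=(u,p)\in X$. -/

import Mathlib

open Filter Topology

noncomputable section

namespace SaddlePoint

/-- Weak convergence `x n ⇀ a` of a sequence in a real normed space. -/
def WeaklyConvergesTo {X : Type*} [NormedAddCommGroup X] [NormedSpace ℝ X]
    (x : ℕ → X) (a : X) : Prop :=
  ∀ φ : StrongDual ℝ X, Tendsto (fun n => φ (x n)) atTop (𝓝 (φ a))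

/-- Weak-* convergence `φ n ⇀* ψ` of a sequence in the dual of a real normed space. -/
def WeakStarConvergesTo {Y : Type*} [NormedAddCommGroup Y] [NormedSpace ℝ Y]
    (φ : ℕ → StrongDual ℝ Y) (ψ : StrongDual ℝ Y) : Prop :=
  ∀ y : Y, Tendsto (fun n => φ n y) atTop (𝓝 (ψ y))

/-- A map `A : X → Y'` is weak-*-continuous if `x n ⇀ a` in `X` implies
`A (x n) ⇀* A a` in `Y'`. -/
def WeakStarContinuous {X Y : Type*} [NormedAddCommGroup X] [NormedSpace ℝ X]
    [NormedAddCommGroup Y] [NormedSpace ℝ Y] (A : X → StrongDual ℝ Y) : Prop :=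
  ∀ (x : ℕ → X) (a : X), WeaklyConvergesTo x a → WeakStarConvergesTo (fun n => A (x n)) (A a)

variable {V Q : Type*} [NormedAddCommGroup V] [NormedSpace ℝ V]
  [NormedAddCommGroup Q] [NormedSpace ℝ Q]

/-- The dual operator `B* : Q → V'` of `B : V → Q'`, given by `⟨B* p, v⟩ = ⟨B v, p⟩`. -/
def dualOp (B : V →L[ℝ] StrongDual ℝ Q) : Q →L[ℝ] StrongDual ℝ V := B.flip

/-- The functional `(g, h) ∈ V' × Q' = (V × Q)'`, given by
`⟨(g, h), (v, q)⟩ = ⟨g, v⟩ + ⟨h, q⟩`. -/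
def dualPair (g : StrongDual ℝ V) (h : StrongDual ℝ Q) : StrongDual ℝ (V × Q) := g.coprod h

/-- The nonlinear saddle-point operator `A (u, p) = (C(u) + L u - B* p, B u + T p)` from `V × Q`
to its dual space. The norm of the product enters only through its topology. -/
def saddleOp (C : V → StrongDual ℝ V) (L : V →L[ℝ] StrongDual ℝ V)
    (B : V →L[ℝ] StrongDual ℝ Q) (T : Q →L[ℝ] StrongDual ℝ Q) (x : V × Q) :
    StrongDual ℝ (V × Q) :=
  dualPair (C x.1 + L x.1 - dualOp B x.2) (B x.1 + T x.2)

end SaddlePoint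

end

open MeasureTheory Metric Set Polynomial
open scoped NNReal ENNReal ContDiff InnerProductSpace Manifold

/-! Test the residual `A(u, p) - (f, 0)` with `(u - δ Θ p, p)`. The `B` terms in `u` and `p` cancel,
and `Θ` supplies the missing control of `p`. The quadratic growth of `C` prevents global coercivity,
so the radius `R` is fixed first, from `f` and `α` alone. Then `δ = ε ^ 2` is taken small and `p` is
rescaled by `ε`, which makes the pairing positive on the sphere of radius `R`
(`SaddlePoint.saddleOp_coercive`). Such positivity gives a zero
(`SaddlePoint.WeakStarContinuous.exists_eq_zero_of_pos_of_sphere`): Galerkin approximations are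
solved by a Brouwer-type argument resting on `not_exists_contDiff_retraction_sphere`, and a weak
limit is taken. -/

/-! ### Determinants and small perturbations of the identity -/

/-- `det (1 + t A)` is a polynomial in `t` of degree at most the dimension. -/
theorem exists_polynomial_eval_eq_det_id_add_smul {E : Type*} [NormedAddCommGroup E]
    [NormedSpace ℝ E] [FiniteDimensional ℝ E] (A : E →L[ℝ] E) :
    ∃ P : ℝ[X], P.degree < (Module.finrank ℝ E + 1 : ℕ) ∧
      ∀ t : ℝ, P.eval t = (ContinuousLinearMap.id ℝ E + t • A).det := by
  let b := Module.finBasis ℝ E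
  let M := LinearMap.toMatrix b b (A : E →ₗ[ℝ] E)
  refine ⟨Matrix.det ((X : ℝ[X]) • M.map C + (1 : Matrix _ _ ℝ).map C), ?_, fun t => ?_⟩
  · refine lt_of_le_of_lt degree_le_natDegree ?_
    have := natDegree_det_X_add_C_le M 1
    rw [Fintype.card_fin] at this
    exact_mod_cast Nat.lt_succ_of_le this
  · rw [ContinuousLinearMap.det, ← LinearMap.det_toMatrix b, ← coe_evalRingHom, RingHom.map_det]
    congr 1
    ext i j
    simp [M, Matrix.one_apply, LinearMap.toMatrix_apply, Finsupp.single_apply, eq_comm, add_comm]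
    split_ifs <;> simp [mul_comm]

theorem ContinuousLinearMap.exists_eq_zero_of_det_eq_zero {E : Type*} [NormedAddCommGroup E]
    [NormedSpace ℝ E] [FiniteDimensional ℝ E] {A : E →L[ℝ] E} (hA : A.det = 0) :
    ∃ x, x ≠ 0 ∧ A x = 0 := by
  have h := LinearMap.bot_lt_ker_of_det_eq_zero (f := (A : E →ₗ[ℝ] E)) hA
  obtain ⟨x, hx, hx0⟩ := Submodule.exists_mem_ne_zero_of_ne_bot h.ne'
  exact ⟨x, hx0, hx⟩

/-- Along the segment from `id` to `id + A` no kernel can appear, so the determinant keeps the sign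
it has at `id`. -/
theorem ContinuousLinearMap.det_id_add_pos_of_norm_lt_one {E : Type*} [NormedAddCommGroup E]
    [NormedSpace ℝ E] [FiniteDimensional ℝ E] (A : E →L[ℝ] E) (hA : ‖A‖ < 1) :
    0 < (ContinuousLinearMap.id ℝ E + A).det := by
  have hne : ∀ s ∈ Icc (0 : ℝ) 1, (ContinuousLinearMap.id ℝ E + s • A).det ≠ 0 := by
    intro s hs h0
    obtain ⟨x, hx0, hx⟩ := exists_eq_zero_of_det_eq_zero h0
    have hx' : x = -(s • A x) := eq_neg_of_add_eq_zero_left (by simpa using hx)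
    have h1 : ‖x‖ ≤ s * (‖A‖ * ‖x‖) := by
      calc ‖x‖ = s * ‖A x‖ := by
            conv_lhs => rw [hx', norm_neg, norm_smul, Real.norm_of_nonneg hs.1]
        _ ≤ _ := by gcongr; exacts [hs.1, A.le_opNorm x]
    have hxp : 0 < ‖x‖ := norm_pos_iff.2 hx0
    have h2 : s * (‖A‖ * ‖x‖) ≤ ‖A‖ * ‖x‖ :=
      mul_le_of_le_one_left (by positivity) hs.2
    nlinarith
  by_contra! hneg
  have hc : ContinuousOn (fun s : ℝ => (ContinuousLinearMap.id ℝ E + s • A).det) (Icc 0 1) :=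
    (ContinuousLinearMap.continuous_det.comp (by fun_prop :
      Continuous fun s : ℝ => ContinuousLinearMap.id ℝ E + s • A)).continuousOn
  obtain ⟨s, hs, h⟩ := intermediate_value_Icc' zero_le_one hc
    (show (0 : ℝ) ∈ Icc _ _ by simpa [ContinuousLinearMap.det] using hneg)
  exact hne s hs h

/-- For `y` outside the ball, its radial projection `z` satisfies `g z = 0` and `‖x - z‖ ≤ 2 * ‖x -
y‖`; this is the source of the factor 2. -/
theorem LipschitzOnWith.indicator_closedBall {E F : Type*} [NormedAddCommGroup E]
    [NormedSpace ℝ E] [NormedAddCommGroup F] {S : ℝ} (hS : 0 < S) {K : ℝ≥0} {g : E → F}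
    (hg : LipschitzOnWith K g (closedBall 0 S)) (h0 : ∀ x, ‖x‖ = S → g x = 0) :
    LipschitzWith (2 * K) ((closedBall (0 : E) S).indicator g) := by
  have key : ∀ x y : E, ‖x‖ ≤ S → S < ‖y‖ → ‖g x‖ ≤ 2 * K * ‖x - y‖ := by
    intro x y hx hy
    have hyp : 0 < ‖y‖ := hS.trans hy
    set z : E := (S / ‖y‖) • y with hz
    have hzn : ‖z‖ = S := by
      rw [hz, norm_smul, Real.norm_of_nonneg (by positivity)]; field_simp
    have hyz : ‖y - z‖ ≤ ‖x - y‖ := by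
      have : y - z = (1 - S / ‖y‖) • y := by rw [hz, sub_smul, one_smul]
      have h1 : S / ‖y‖ ≤ 1 := (div_le_one hyp).2 hy.le
      rw [this, norm_smul, Real.norm_of_nonneg (by linarith)]
      have : (1 - S / ‖y‖) * ‖y‖ = ‖y‖ - S := by field_simp
      have h2 := norm_sub_norm_le y x
      rw [norm_sub_rev] at h2
      linarith
    have h3 := hg.dist_le_mul x (by simpa using hx) z (by simp [hzn])
    rw [h0 z hzn, dist_zero_right, dist_eq_norm] at h3
    have h4 : ‖x - z‖ ≤ 2 * ‖x - y‖ := by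
      have := norm_add_le (x - y) (y - z)
      rw [sub_add_sub_cancel] at this
      linarith
    calc ‖g x‖ ≤ K * ‖x - z‖ := h3
      _ ≤ K * (2 * ‖x - y‖) := by gcongr
      _ = _ := by ring
  refine LipschitzWith.of_dist_le_mul fun x y => ?_
  rw [dist_eq_norm, dist_eq_norm, NNReal.coe_mul, NNReal.coe_ofNat]
  by_cases hx : x ∈ closedBall (0 : E) S <;> by_cases hy : y ∈ closedBall (0 : E) S
  · rw [indicator_of_mem hx, indicator_of_mem hy]
    have := hg.dist_le_mul x hx y hy
    rw [dist_eq_norm, dist_eq_norm] at this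
    have : 0 ≤ (K : ℝ) * ‖x - y‖ := by positivity
    linarith
  · rw [indicator_of_mem hx, indicator_of_notMem hy, sub_zero]
    exact key x y (by simpa using hx) (by simpa using hy)
  · rw [indicator_of_notMem hx, indicator_of_mem hy, zero_sub, norm_neg, norm_sub_rev]
    exact key y x (by simpa using hy) (by simpa using hx)
  · rw [indicator_of_notMem hx, indicator_of_notMem hy, sub_zero, norm_zero]
    positivity

/-- With `g` cut off, the contraction principle makes `id + G` a bijection of the whole space. It
fixes every point outside the open ball, hence permutes the ball. -/
theorem bijOn_ball_id_add_indicator {E : Type*} [NormedAddCommGroup E] [NormedSpace ℝ E]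
    [CompleteSpace E] {S : ℝ} {K : ℝ≥0} {g : E → E}
    (hg : LipschitzWith K ((closedBall (0 : E) S).indicator g)) (hK : K < 1)
    (h0 : ∀ x, ‖x‖ = S → g x = 0) :
    BijOn (fun x => x + g x) (ball 0 S) (ball 0 S) := by
  set G := (closedBall (0 : E) S).indicator g
  have hGout : ∀ x, S ≤ ‖x‖ → G x = 0 := by
    intro x hx
    rcases hx.eq_or_lt with h | h
    · exact (indicator_of_mem (by simp [h]) g).trans (h0 x h.symm)
    · exact indicator_of_notMem (by simpa using h) g
  have hGin : ∀ x ∈ ball (0 : E) S, G x = g x := fun x hx =>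
    indicator_of_mem (ball_subset_closedBall hx) g
  have hinj : Function.Injective fun x => x + G x := by
    intro x y hxy
    have h1 : x - y = G y - G x := by
      have : x + G x = y + G y := hxy
      rw [sub_eq_sub_iff_add_eq_add, this, add_comm]
    have h2 := hg.dist_le_mul y x
    rw [dist_eq_norm, dist_eq_norm, ← h1, norm_sub_rev y x] at h2
    have hK' : (K : ℝ) < 1 := hK
    have : ‖x - y‖ = 0 := by nlinarith [norm_nonneg (x - y)]
    exact sub_eq_zero.1 (norm_eq_zero.1 this)
  have hsurj : Function.Surjective fun x => x + G x := by
    intro y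
    have hc : ContractingWith K fun x => y - G x := ⟨hK, by
      refine LipschitzWith.of_dist_le_mul fun a b => ?_
      rw [dist_sub_left]
      exact hg.dist_le_mul a b⟩
    refine ⟨hc.fixedPoint, ?_⟩
    have := hc.fixedPoint_isFixedPt
    exact (eq_sub_iff_add_eq.1 this.eq.symm)
  refine BijOn.congr (f₁ := fun x => x + G x) ⟨?_, hinj.injOn, ?_⟩ fun x hx => by
    simp only [hGin x hx]
  · intro x hx
    by_contra hy
    have h1 : S ≤ ‖x + G x‖ := by simpa using hy
    have h2 : x + G x = x := hinj (by simp only [hGout _ h1, add_zero])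
    rw [h2] at h1
    exact absurd (mem_ball_zero_iff.1 hx) h1.not_gt
  · intro y hy
    obtain ⟨x, rfl⟩ := hsurj y
    refine ⟨x, ?_, rfl⟩
    by_contra hx
    have h1 : S ≤ ‖x‖ := by simpa using hx
    simp only [hGout _ h1, add_zero] at hy
    exact hx hy

/-! ### No-retraction theorem -/

/-- There is no `C¹` retraction onto a sphere: if `r` were one, then `∫ det (1 + t (r' - 1))` over the
ball would be polynomial in `t`, equal to the volume of the ball for small `t`, and `0` at `t = 1`. -/
theorem not_exists_contDiff_retraction_sphere {E : Type*} [NormedAddCommGroup E]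
    [InnerProductSpace ℝ E] [FiniteDimensional ℝ E] {S : ℝ} (hS : 0 < S) {r : E → E}
    (hr : ContDiff ℝ 1 r) (hrS : ∀ x, ‖r x‖ = S) (hid : ∀ x, ‖x‖ = S → r x = x) : False := by
  borelize E
  set g : E → E := fun x => r x - x with hg_def
  have hg : ContDiff ℝ 1 g := hr.sub contDiff_id
  have hg' : Continuous (fderiv ℝ g) := hg.continuous_fderiv one_ne_zero
  have hgd : ∀ x, HasFDerivAt g (fderiv ℝ g x) x := fun x =>
    (hg.differentiable one_ne_zero x).hasFDerivAt
  have hg0 : ∀ x, ‖x‖ = S → g x = 0 := fun x hx => sub_eq_zero.2 (hid x hx)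
  obtain ⟨K₀, hK₀⟩ := (isCompact_closedBall (0 : E) S).exists_bound_of_continuousOn
    hg'.continuousOn
  set K : ℝ≥0 := K₀.toNNReal + 1
  have hKb : ∀ x ∈ closedBall (0 : E) S, ‖fderiv ℝ g x‖ ≤ K := fun x hx =>
    (hK₀ x hx).trans ((Real.le_coe_toNNReal K₀).trans (by simp [K]))
  have hKpos : (0 : ℝ) < K := by positivity
  have hlip : LipschitzOnWith K g (closedBall 0 S) :=
    (convex_closedBall (0 : E) S).lipschitzOnWith_of_nnnorm_fderiv_le
      (fun x _ => (hgd x).differentiableAt) fun x hx => hKb x hx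
  have hint : ∀ t : ℝ, IntegrableOn
      (fun x => (ContinuousLinearMap.id ℝ E + t • fderiv ℝ g x).det) (ball 0 S) := by
    intro t
    have hc : Continuous fun x => (ContinuousLinearMap.id ℝ E + t • fderiv ℝ g x).det :=
      ContinuousLinearMap.continuous_det.comp (by fun_prop)
    exact (hc.continuousOn.integrableOn_compact (isCompact_closedBall 0 S)).mono_set
      ball_subset_closedBall
  have hsmall : ∀ t : ℝ, 0 ≤ t → t * (2 * K) < 1 →
      ∫ x in ball (0 : E) S, (ContinuousLinearMap.id ℝ E + t • fderiv ℝ g x).det =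
        volume.real (ball (0 : E) S) := by
    intro t ht htK
    have hl : LipschitzOnWith (t.toNNReal * K) (fun x => t • g x) (closedBall 0 S) := by
      refine LipschitzOnWith.of_dist_le_mul fun x hx y hy => ?_
      rw [dist_smul₀, Real.norm_of_nonneg ht, NNReal.coe_mul, Real.coe_toNNReal t ht, mul_assoc]
      gcongr
      exact hlip.dist_le_mul x hx y hy
    have ht0 : ∀ x, ‖x‖ = S → t • g x = 0 := fun x hx => by rw [hg0 x hx, smul_zero]
    have hlt : 2 * (t.toNNReal * K) < 1 := by
      rw [← NNReal.coe_lt_coe]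
      push_cast
      rw [Real.coe_toNNReal t ht]
      linarith
    have hbij := bijOn_ball_id_add_indicator (hl.indicator_closedBall hS ht0) hlt ht0
    have hcv := integral_image_eq_integral_abs_det_fderiv_smul volume measurableSet_ball
      (f := fun x => x + t • g x)
      (f' := fun x => ContinuousLinearMap.id ℝ E + t • fderiv ℝ g x)
      (fun x _ => ((hasFDerivAt_id x).add ((hgd x).const_smul t)).hasFDerivWithinAt)
      hbij.injOn (fun _ => (1 : ℝ))
    rw [hbij.image_eq] at hcv
    simp only [smul_eq_mul, mul_one, integral_const, MeasurableSet.univ, measureReal_restrict_apply,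
      univ_inter] at hcv
    rw [hcv]
    refine setIntegral_congr_fun measurableSet_ball fun x hx => ?_
    refine (abs_of_pos (ContinuousLinearMap.det_id_add_pos_of_norm_lt_one _ ?_)).symm
    rw [norm_smul, Real.norm_of_nonneg ht]
    calc t * ‖fderiv ℝ g x‖ ≤ t * K := by gcongr; exact hKb x (ball_subset_closedBall hx)
      _ ≤ t * (2 * K) := by gcongr; linarith
      _ < 1 := htK
  have hdet : ∀ x, (ContinuousLinearMap.id ℝ E + (1 : ℝ) • fderiv ℝ g x).det = 0 := by
    intro x
    have hrx : HasFDerivAt r (ContinuousLinearMap.id ℝ E + (1 : ℝ) • fderiv ℝ g x) x := by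
      rw [one_smul]
      convert! (hasFDerivAt_id x).add (hgd x) using 1
      ext y
      simp [g]
    -- Since `‖r‖ ^ 2` is constant, the range of `R'` is orthogonal to `r x ≠ 0`.
    set R' := ContinuousLinearMap.id ℝ E + (1 : ℝ) • fderiv ℝ g x
    by_contra hne
    have hsurj : Function.Surjective R' := by
      have hu : IsUnit (LinearMap.det (R' : E →ₗ[ℝ] E)) := isUnit_iff_ne_zero.2 hne
      exact fun y => ((LinearMap.equivOfIsUnitDet hu).surjective y).imp fun v hv => by
        simpa using hv
    obtain ⟨v, hv⟩ := hsurj (r x)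
    have h1 := hrx.norm_sq
    have h2 : (fun y => ‖r y‖ ^ 2) = fun _ => S ^ 2 := by ext y; rw [hrS]
    rw [h2] at h1
    have h3 := congrArg (fun L => L v) (h1.unique (hasFDerivAt_const (S ^ 2) x))
    simp [hv, hrS, hS.ne'] at h3
  set n := Module.finrank ℝ E
  -- `n + 1` distinct small times: enough nodes to recover a polynomial of degree at most `n` at
  -- time 1.
  set v : ℕ → ℝ := fun i => (1 / (2 * K + 1)) * (1 / ((i : ℝ) + 1)) with hv
  have hvinj : InjOn v (Finset.range (n + 1)) := by
    intro i _ j _ hij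
    have h : (0 : ℝ) < 1 / (2 * K + 1) := by positivity
    have := mul_left_cancel₀ h.ne' hij
    simpa using this
  have hvpos : ∀ i, 0 ≤ v i := fun i => by positivity
  have hvlt : ∀ i, v i * (2 * K) < 1 := by
    intro i
    have h1 : 1 / ((i : ℝ) + 1) ≤ 1 := by
      rw [div_le_one (by positivity)]; linarith [Nat.cast_nonneg (α := ℝ) i]
    calc v i * (2 * K) ≤ (1 / (2 * K + 1)) * 1 * (2 * K) := by simp only [hv]; gcongr
      _ < 1 := by rw [mul_one, one_div, inv_mul_lt_one₀ (by positivity)]; linarith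
  have hlag : ∀ x, (ContinuousLinearMap.id ℝ E + (1 : ℝ) • fderiv ℝ g x).det =
      ∑ i ∈ Finset.range (n + 1),
        (ContinuousLinearMap.id ℝ E + v i • fderiv ℝ g x).det *
          (Lagrange.basis (Finset.range (n + 1)) v i).eval 1 := by
    intro x
    obtain ⟨P, hPd, hP⟩ := exists_polynomial_eval_eq_det_id_add_smul (fderiv ℝ g x)
    have := Lagrange.eq_interpolate (f := P) hvinj (by simpa using hPd)
    rw [← hP 1, this, Lagrange.interpolate_apply, eval_finsetSum]
    simp [hP]
  have hvol : volume.real (ball (0 : E) S) = 0 := by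
    have h1 : ∫ x in ball (0 : E) S, (ContinuousLinearMap.id ℝ E + (1 : ℝ) • fderiv ℝ g x).det
        = volume.real (ball (0 : E) S) := by
      simp_rw [hlag]
      rw [integral_finsetSum _ fun i _ => (hint (v i)).mul_const _]
      simp_rw [integral_mul_const, hsmall _ (hvpos _) (hvlt _)]
      rw [← Finset.mul_sum, ← eval_finsetSum, Lagrange.sum_basis hvinj (by simp), eval_one, mul_one]
    rw [← h1]
    simp_rw [hdet]
    simp
  have : 0 < volume.real (ball (0 : E) S) :=
    ENNReal.toReal_pos (measure_ball_pos volume _ hS).ne' measure_ball_lt_top.ne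
  exact this.ne' hvol

/-! ### Zeros of outward-pointing fields -/

/-- A continuous vector field pointing outwards on a sphere has a zero in the ball. -/
theorem exists_eq_zero_of_inner_pos_of_sphere {E : Type*} [NormedAddCommGroup E]
    [InnerProductSpace ℝ E] [FiniteDimensional ℝ E] {R : ℝ} (hR : 0 < R) {F : E → E}
    (hF : Continuous F) (hpos : ∀ x, ‖x‖ = R → 0 < ⟪F x, x⟫_ℝ) :
    ∃ x, ‖x‖ ≤ R ∧ F x = 0 := by
  by_contra! hne
  set m : E → ℝ := fun x => max 1 (‖x‖ / R)
  have hm : ∀ x, 0 < m x := fun x => lt_of_lt_of_le one_pos (le_max_left _ _)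
  have hmc : Continuous m := by fun_prop
  set F₁ : E → E := fun x => F ((m x)⁻¹ • x)
  have hF₁ : Continuous F₁ := hF.comp ((hmc.inv₀ fun x => (hm x).ne').smul continuous_id)
  have hF₁0 : ∀ x, F₁ x ≠ 0 := by
    intro x
    refine hne _ ?_
    rw [norm_smul, norm_inv, Real.norm_of_nonneg (hm x).le, inv_mul_le_iff₀ (hm x),
      ← div_le_iff₀ hR]
    exact le_max_right _ _
  have hF₁pos : ∀ x, R ≤ ‖x‖ → 0 < ⟪x, F₁ x⟫_ℝ := by
    intro x hx
    have hmx : m x = ‖x‖ / R := max_eq_right ((one_le_div hR).2 hx)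
    have hxp : 0 < ‖x‖ := hR.trans_le hx
    have := hpos ((m x)⁻¹ • x) (by
      rw [norm_smul, norm_inv, Real.norm_of_nonneg (hm x).le, hmx]; field_simp)
    rw [real_inner_smul_right, real_inner_comm] at this
    exact (pos_iff_pos_of_mul_pos this).1 (inv_pos.2 (hm x))
  -- Convex constraints, so local solutions glue by a partition of unity to a `C¹` field that never
  -- vanishes and is the identity where `2 * R ≤ ‖x‖`; normalising it gives a forbidden retraction.
  set t : E → Set E := fun x => {y | 0 < ⟪y, F₁ x⟫_ℝ ∧ (2 * R ≤ ‖x‖ → y = x)}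
  have ht : ∀ x, Convex ℝ (t x) := by
    intro x y hy z hz a b ha hb hab
    refine ⟨?_, fun hx => ?_⟩
    · rw [inner_add_left, real_inner_smul_left, real_inner_smul_left]
      rcases ha.eq_or_lt with rfl | ha
      · rw [show b = 1 by linarith]; simpa using hz.1
      · have := mul_pos ha hy.1
        have := mul_nonneg hb hz.1.le
        linarith
    · rw [hy.2 hx, hz.2 hx, ← add_smul, hab, one_smul]
  obtain ⟨G, hG⟩ := exists_contMDiffMap_forall_mem_convex_of_local (n := 1) 𝓘(ℝ, E) ht (by
    intro x
    rcases le_or_gt ‖x‖ R with hx | hx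
    · have hcont : Continuous fun y => ⟪F₁ x, F₁ y⟫_ℝ := by fun_prop
      have h1 : ∀ᶠ y in 𝓝 x, 0 < ⟪F₁ x, F₁ y⟫_ℝ :=
        hcont.continuousAt.eventually (lt_mem_nhds (real_inner_self_pos.2 (hF₁0 x)))
      have h2 : ∀ᶠ y in 𝓝 x, ‖y‖ < 2 * R :=
        continuous_norm.continuousAt.eventually (gt_mem_nhds (by linarith))
      exact ⟨_, h1.and h2, fun _ => F₁ x, contMDiffOn_const, fun y hy =>
        ⟨hy.1, fun h => absurd hy.2 h.not_gt⟩⟩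
    · have h1 : ∀ᶠ y in 𝓝 x, R < ‖y‖ :=
        continuous_norm.continuousAt.eventually (lt_mem_nhds hx)
      exact ⟨_, h1, id, contMDiffOn_id, fun y hy => ⟨hF₁pos y (le_of_lt hy), fun _ => rfl⟩⟩)
  have hGs : ContDiff ℝ 1 G := G.contMDiff.contDiff
  have hG0 : ∀ x, G x ≠ 0 := fun x h => by
    have := (hG x).1
    rw [h, inner_zero_left] at this
    exact lt_irrefl _ this
  have hGn : ∀ x, ‖G x‖ ≠ 0 := fun x => norm_ne_zero_iff.2 (hG0 x)
  refine not_exists_contDiff_retraction_sphere (S := 2 * R) (by positivity)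
    (r := fun x => (2 * R / ‖G x‖) • G x)
    ((contDiff_const.div (hGs.norm ℝ hG0) hGn).smul hGs) (fun x => ?_) fun x hx => ?_
  · rw [norm_smul, Real.norm_of_nonneg (by positivity)]
    field_simp [hGn x]
  · rw [(hG x).2 hx.ge, hx, div_self (by positivity), one_smul]

/-! ### Weak compactness and Galerkin approximation -/

/-- Bounded sequences in a separable Hilbert space have weakly convergent subsequences. -/
theorem exists_weaklyConvergesTo_subseq {H : Type*} [NormedAddCommGroup H]
    [InnerProductSpace ℝ H] [CompleteSpace H] [TopologicalSpace.SeparableSpace H] {R : ℝ}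
    {x : ℕ → H} (hx : ∀ n, ‖x n‖ ≤ R) :
    ∃ (a : H) (φ : ℕ → ℕ), StrictMono φ ∧ SaddlePoint.WeaklyConvergesTo (x ∘ φ) a := by
  have hc := WeakDual.isSeqCompact_closedBall ℝ H 0 R
  obtain ⟨l, -, φ, hφ, hl⟩ := hc
    (x := fun n => StrongDual.toWeakDual (InnerProductSpace.toDual ℝ H (x n))) fun n => by
      simpa using hx n
  refine ⟨(InnerProductSpace.toDual ℝ H).symm (WeakDual.toStrongDual l), φ, hφ, fun ψ => ?_⟩
  have h := ((WeakDual.eval_continuous ((InnerProductSpace.toDual ℝ H).symm ψ)).tendsto l).comp hl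
  have h1 : ∀ y : H, ψ y = ⟪y, (InnerProductSpace.toDual ℝ H).symm ψ⟫_ℝ := fun y => by
    rw [real_inner_comm, InnerProductSpace.toDual_symm_apply]
  simp_rw [h1, InnerProductSpace.toDual_symm_apply]
  exact h

theorem ContinuousLinearMap.weaklyConvergesTo {X Y : Type*} [NormedAddCommGroup X]
    [NormedSpace ℝ X] [NormedAddCommGroup Y] [NormedSpace ℝ Y] (S : X →L[ℝ] Y) {x : ℕ → X} {a : X}
    (h : SaddlePoint.WeaklyConvergesTo x a) :
    SaddlePoint.WeaklyConvergesTo (fun n => S (x n)) (S a) :=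
  fun ψ => h (ψ.comp S)

/-- Solvability of the Galerkin approximation on a finite-dimensional subspace. -/
theorem exists_eq_zero_on_submodule {H : Type*} [NormedAddCommGroup H]
    [InnerProductSpace ℝ H] {Φ : H → StrongDual ℝ H}
    (hΦ : SaddlePoint.WeakStarContinuous Φ) {R : ℝ} (hR : 0 < R)
    (hpos : ∀ x, ‖x‖ = R → 0 < Φ x x) (W : Submodule ℝ H) [FiniteDimensional ℝ W] :
    ∃ x ∈ W, ‖x‖ ≤ R ∧ ∀ y ∈ W, Φ x y = 0 := by
  set F : W → W := fun x => (InnerProductSpace.toDual ℝ W).symm ((Φ x).comp W.subtypeL)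
  have hFin : ∀ x y : W, ⟪F x, y⟫_ℝ = Φ x y := fun x y => by
    simp [F, InnerProductSpace.toDual_symm_apply]
  have hF : Continuous F := by
    refine (InnerProductSpace.toDual ℝ W).symm.continuous.comp ?_
    -- In finite dimension, pointwise convergence of functionals suffices; strong convergence in `W`
    -- implies weak convergence in `H`.
    refine continuous_clm_apply.2 fun y => continuous_iff_seqContinuous.2 fun x a hx => ?_
    exact hΦ (fun n => (x n : H)) a
      (fun ψ => (ψ.continuous.tendsto _).comp ((continuous_subtype_val.tendsto a).comp hx)) y
  obtain ⟨x, hx, hx0⟩ := exists_eq_zero_of_inner_pos_of_sphere hR hF fun x hx => by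
    rw [hFin]; exact hpos x hx
  refine ⟨x, x.2, hx, fun y hy => ?_⟩
  rw [← hFin x ⟨y, hy⟩, hx0, inner_zero_left]

/-- A weak-*-continuous map `H → H'` that is positive on the diagonal of a sphere has a zero. -/
theorem SaddlePoint.WeakStarContinuous.exists_eq_zero_of_pos_of_sphere {H : Type*}
    [NormedAddCommGroup H] [InnerProductSpace ℝ H] [CompleteSpace H]
    [TopologicalSpace.SeparableSpace H] {Φ : H → StrongDual ℝ H}
    (hΦ : SaddlePoint.WeakStarContinuous Φ) {R : ℝ} (hR : 0 < R)
    (hpos : ∀ x, ‖x‖ = R → 0 < Φ x x) : ∃ x, Φ x = 0 := by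
  set d := TopologicalSpace.denseSeq H
  have hgal : ∀ n : ℕ, ∃ x, ‖x‖ ≤ R ∧ ∀ k < n, Φ x (d k) = 0 := by
    intro n
    have hfin : (d '' Iio n).Finite := (finite_Iio n).image d
    have := FiniteDimensional.span_of_finite ℝ hfin
    obtain ⟨x, -, hx, h0⟩ := exists_eq_zero_on_submodule hΦ hR hpos (Submodule.span ℝ (d '' Iio n))
    exact ⟨x, hx, fun k hk => h0 _ (Submodule.subset_span (mem_image_of_mem d hk))⟩
  choose x hx hx0 using hgal
  obtain ⟨a, φ, hφ, ha⟩ := exists_weaklyConvergesTo_subseq hx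
  refine ⟨a, ?_⟩
  have hd : ∀ k, Φ a (d k) = 0 := by
    intro k
    refine tendsto_nhds_unique (hΦ _ a ha (d k)) (tendsto_const_nhds.congr' ?_)
    filter_upwards [eventually_gt_atTop k] with n hn
    exact (hx0 (φ n) k (hn.trans_le (hφ.id_le n))).symm
  have := Continuous.ext_on (TopologicalSpace.denseRange_denseSeq H) (Φ a).continuous
    continuous_const (g := fun _ => (0 : ℝ)) (by rintro _ ⟨k, rfl⟩; exact hd k)
  exact ContinuousLinearMap.ext fun y => congrFun this y

/-! ### The saddle-point operator -/

theorem SaddlePoint.saddleOp_sub_dualPair_apply {V Q : Type*} [NormedAddCommGroup V]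
    [NormedSpace ℝ V] [NormedAddCommGroup Q] [NormedSpace ℝ Q]
    (C : V → StrongDual ℝ V) (L : V →L[ℝ] StrongDual ℝ V) (B : V →L[ℝ] StrongDual ℝ Q)
    (T : Q →L[ℝ] StrongDual ℝ Q) (f : StrongDual ℝ V) (u v : V) (p q : Q) :
    (saddleOp C L B T (u, p) - dualPair f 0 : StrongDual ℝ (V × Q)) (v, q) =
      C u v + L u v - dualOp B p v - f v + (B u q + T p q) := by
  simp [saddleOp, dualPair]
  ring

/-- Lower bound for the saddle-point operator tested with `(u - δ Θ p, p)`. -/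
theorem SaddlePoint.saddleOp_coercive {V Q : Type*} [NormedAddCommGroup V]
    [NormedSpace ℝ V] [NormedAddCommGroup Q] [NormedSpace ℝ Q]
    {C : V → StrongDual ℝ V} {L : V →L[ℝ] StrongDual ℝ V} {B : V →L[ℝ] StrongDual ℝ Q}
    {T : Q →L[ℝ] StrongDual ℝ Q} {Θ : Q →L[ℝ] V} {α cT cN : ℝ}
    (hL : ∀ u : V, α * ‖u‖ ^ 2 ≤ L u u) (hT : ∀ p : Q, 0 ≤ T p p)
    (hΘ : ∀ p : Q, (1 / 2 : ℝ) * ‖p‖ ^ 2 - cT * T p p ≤ dualOp B p (Θ p))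
    (hC : ∀ u : V, 0 ≤ C u u) (hcN : 0 ≤ cN) (hCN : ∀ u : V, ‖C u‖ ≤ cN * ‖u‖ ^ 2)
    (f : StrongDual ℝ V) {δ : ℝ} (hδ : 0 ≤ δ) (hδT : δ * cT ≤ 1) (u : V) (p : Q) :
    α * ‖u‖ ^ 2 - ‖f‖ * ‖u‖ + δ * ((1 / 2 : ℝ) * ‖p‖ ^ 2)
        - δ * ((cN * ‖u‖ ^ 2 + ‖L‖ * ‖u‖ + ‖f‖) * (‖Θ‖ * ‖p‖)) ≤
      (saddleOp C L B T (u, p) - dualPair f 0 : StrongDual ℝ (V × Q)) (u - δ • Θ p, p) := by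
  have hB : dualOp B p u = B u p := rfl
  have hN : ‖C u + L u - f‖ ≤ cN * ‖u‖ ^ 2 + ‖L‖ * ‖u‖ + ‖f‖ :=
    (norm_sub_le _ _).trans (add_le_add_left ((norm_add_le _ _).trans
      (add_le_add (hCN u) (L.le_opNorm u))) _)
  have h1 : (C u + L u - f) (Θ p) ≤
      (cN * ‖u‖ ^ 2 + ‖L‖ * ‖u‖ + ‖f‖) * (‖Θ‖ * ‖p‖) :=
    (le_abs_self _).trans (((C u + L u - f).le_opNorm (Θ p)).trans
      (mul_le_mul hN (Θ.le_opNorm p) (norm_nonneg _) (by positivity)))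
  have h2 : f u ≤ ‖f‖ * ‖u‖ := (le_abs_self _).trans (f.le_opNorm u)
  have h3 := mul_le_mul_of_nonneg_left h1 hδ
  have h4 := mul_le_mul_of_nonneg_left (hΘ p) hδ
  have h5 := mul_le_mul_of_nonneg_right hδT (hT p)
  have h6 := hL u
  have h7 := hC u
  rw [saddleOp_sub_dualPair_apply]
  simp only [map_sub, map_smul, smul_eq_mul, hB]
  simp only [sub_apply, add_apply] at h3
  linarith

theorem mainTheorem1
    {V Q : Type*}
    [NormedAddCommGroup V] [InnerProductSpace ℝ V] [CompleteSpace V]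
    [TopologicalSpace.SeparableSpace V]
    [NormedAddCommGroup Q] [InnerProductSpace ℝ Q] [CompleteSpace Q]
    [TopologicalSpace.SeparableSpace Q]
    (C : V → StrongDual ℝ V) (L : V →L[ℝ] StrongDual ℝ V)
    (B : V →L[ℝ] StrongDual ℝ Q) (T : Q →L[ℝ] StrongDual ℝ Q)
    (hA : SaddlePoint.WeakStarContinuous (SaddlePoint.saddleOp C L B T))
    (hA1 : ∃ α : ℝ, 0 < α ∧ ∀ u : V, α * ‖u‖ ^ 2 ≤ L u u)
    (hA2a : ∀ p : Q, 0 ≤ T p p)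
    (hA2b : ∃ (Θ : Q →L[ℝ] V) (cT : ℝ), ∀ p : Q,
      (1 / 2 : ℝ) * ‖p‖ ^ 2 - cT * T p p ≤ SaddlePoint.dualOp B p (Θ p))
    (hA3 : ∀ u : V, 0 ≤ C u u)
    (hA4 : ∃ cN : ℝ, ∀ u : V, ‖C u‖ ≤ cN * ‖u‖ ^ 2)
    (f : StrongDual ℝ V) :
    ∃ x : V × Q, SaddlePoint.saddleOp C L B T x = SaddlePoint.dualPair f 0 := by
  obtain ⟨α, hα, hL⟩ := hA1
  obtain ⟨Θ, cT, hΘ⟩ := hA2b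
  obtain ⟨cN₀, hcN₀⟩ := hA4
  set cN := |cN₀|
  have hCN : ∀ u : V, ‖C u‖ ≤ cN * ‖u‖ ^ 2 := fun u =>
    (hcN₀ u).trans (by gcongr; exact le_abs_self _)
  set β := min α (1 / 2)
  have hβ : 0 < β := lt_min hα (by norm_num)
  -- Makes `β * R ^ 2` exceed `‖f‖ * R` by exactly `R`, the room left for the cross term.
  set R := (‖f‖ + 1) / β
  have hR : 0 < R := by positivity
  have hβR : β * R = ‖f‖ + 1 := mul_div_cancel₀ _ hβ.ne'
  set N := cN * R ^ 2 + ‖L‖ * R + ‖f‖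
  have hN : 0 ≤ N := by positivity
  -- `N` bounds `C u + L u - f` for `‖u‖ ≤ R`. This `ε` gives both `ε * (N * ‖Θ‖) < 1` and `ε ^ 2 *
  -- cT ≤ 1`.
  set ε := 1 / (1 + N * ‖Θ‖ + |cT|)
  have hε : 0 < ε := by positivity
  have hε_mul : ε * (1 + N * ‖Θ‖ + |cT|) = 1 := one_div_mul_cancel (by positivity)
  have hεN : 0 ≤ ε * (N * ‖Θ‖) := by positivity
  have hεT : 0 ≤ ε * |cT| := by positivity
  have hε1 : ε ≤ 1 := by linarith
  have hδT : ε ^ 2 * cT ≤ 1 := by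
    calc ε ^ 2 * cT ≤ ε * (ε * |cT|) := by
          rw [pow_two, mul_assoc]; gcongr; exact le_abs_self _
      _ ≤ 1 * 1 := by gcongr; linarith
      _ = 1 := one_mul 1
  -- The sup norm of `V × Q` is not Hilbertian; weak convergence depends only on the topology.
  let e := WithLp.prodContinuousLinearEquiv 2 ℝ V Q
  have : TopologicalSpace.SeparableSpace (WithLp 2 (V × Q)) :=
    e.symm.surjective.denseRange.separableSpace e.symm.continuous
  let S : WithLp 2 (V × Q) →L[ℝ] V × Q :=
    ((ContinuousLinearMap.fst ℝ V Q).prod (ε⁻¹ • ContinuousLinearMap.snd ℝ V Q)).comp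
      (e : WithLp 2 (V × Q) →L[ℝ] V × Q)
  let M : V × Q →L[ℝ] V × Q :=
    (ContinuousLinearMap.fst ℝ V Q - ε ^ 2 • Θ.comp (ContinuousLinearMap.snd ℝ V Q)).prod
      (ContinuousLinearMap.snd ℝ V Q)
  -- Surjectivity lets a zero of the modified functional annihilate all test pairs.
  have hMS : Function.Surjective (M.comp S) := fun y =>
    ⟨e.symm (y.1 + ε ^ 2 • Θ y.2, ε • y.2), by
      ext <;> simp [M, S, smul_smul, hε.ne']⟩
  let Φ : WithLp 2 (V × Q) → StrongDual ℝ (WithLp 2 (V × Q)) := fun w =>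
    (SaddlePoint.saddleOp C L B T (S w) - SaddlePoint.dualPair f 0).comp (M.comp S)
  have hΦ : SaddlePoint.WeakStarContinuous Φ := fun w a hw y =>
    (hA _ _ (S.weaklyConvergesTo hw) (M (S y))).sub_const _
  obtain ⟨w, hw⟩ := hΦ.exists_eq_zero_of_pos_of_sphere hR (by
    intro w hw
    set u := (e w).1
    set p' := (e w).2
    set p := ε⁻¹ • p'
    have hn : ‖u‖ ^ 2 + ‖p'‖ ^ 2 = R ^ 2 := by
      rw [← hw, WithLp.prod_norm_sq_eq_of_L2]; rfl
    have hu : ‖u‖ ≤ R := abs_le_of_sq_le_sq' (by nlinarith [sq_nonneg ‖p'‖]) hR.le |>.2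
    have hp' : ‖p'‖ ≤ R := abs_le_of_sq_le_sq' (by nlinarith [sq_nonneg ‖u‖]) hR.le |>.2
    have hp : ε * ‖p‖ = ‖p'‖ := by
      rw [norm_smul, norm_inv, Real.norm_of_nonneg hε.le, mul_inv_cancel_left₀ hε.ne']
    have key := SaddlePoint.saddleOp_coercive hL hA2a hΘ hA3 (abs_nonneg cN₀) hCN f
      (sq_nonneg ε) hδT u p
    have hN' : ε ^ 2 * ((cN * ‖u‖ ^ 2 + ‖L‖ * ‖u‖ + ‖f‖) * (‖Θ‖ * ‖p‖)) ≤
        ε * (N * ‖Θ‖) * R := by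
      calc _ = ε * ((cN * ‖u‖ ^ 2 + ‖L‖ * ‖u‖ + ‖f‖) * ‖Θ‖) * (ε * ‖p‖) := by ring
        _ ≤ _ := by rw [hp]; simp only [N]; gcongr
    have hp2 : ε ^ 2 * ((1 / 2 : ℝ) * ‖p‖ ^ 2) = 1 / 2 * ‖p'‖ ^ 2 := by rw [← hp]; ring
    have h1 : β * R ^ 2 ≤ α * ‖u‖ ^ 2 + 1 / 2 * ‖p'‖ ^ 2 := by
      rw [← hn, mul_add]
      gcongr
      exacts [min_le_left _ _, min_le_right _ _]
    have h2 : β * R ^ 2 = (‖f‖ + 1) * R := by rw [← hβR]; ring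
    have h3 : ‖f‖ * ‖u‖ ≤ ‖f‖ * R := by gcongr
    have h4 : ε * (N * ‖Θ‖) * R < 1 * R := by gcongr; linarith
    refine lt_of_lt_of_le ?_ key
    linarith)
  refine ⟨S w, sub_eq_zero.1 (ContinuousLinearMap.ext fun y => ?_)⟩
  obtain ⟨z, rfl⟩ := hMS y
  exact congrArg (fun φ => φ z) hw
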